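/- Let $d\ge 1$, $\theta>0$, $x_1,m_1\in\mathbb{R}^d$, and let $s_1\in\mathbb{R}^{d\times d}$ be symmetric positive definite. Let $(W_n)_{n\ge 2}$ be i.i.d. random vectors in $\mathbb{R}^d$ on a probability space, whose common distribution is spherically symmetric (invariant under every orthogonal transformation of $\mathbb{R}^d$) and non-degenerate (not the point mass at $0$); for instance, any spherically symmetric distribution with a density. Let $(\eta_n)_{n\ge 2}\subset(0,1)$ satisfy $$\lim_{n\to\infty}\frac{\eta_{n+1}}{\eta_n}=1,\qquad \sum_{n=2}^\infty \eta_n=\infty,\qquad \sum_{n=2}^\infty \eta_n^2<\infty .$$ Let $X_1= x_1$, $M_1= m_1$, $S_1= s_1$ and suppose that, almost surely, for all $n\ge 1$, $$X_{n+1}=X_n+\theta S_n^{1/2}W_{n+1},$$ $$M_{n+1}=(1-\eta_{n+1})M_n+\eta_{n+1}X_{n+1},$$ $$S_{n+1}=(1-\eta_{n+1})S_n+\eta_{n+1}(X_{n+1}-M_n)(X_{n+1}-M_n)^T,$$ where $S_n^{1/2}$ is the symmetric positive semidefinite square root of $S_n$. Then, for every unit vector $u\in\mathbb{R}^d$, $u^TS_nu\to\infty$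 almost surely as $n\to\infty$. -/

import Mathlib

open MeasureTheory ProbabilityTheory Filter Topology
open scoped Matrix MatrixOrder

/-- A measure on `ℝ^d` is spherically symmetric if it is invariant under every orthogonal
transformation (reflections included, so that for `d = 1` this is symmetry about `0`). -/
def SphericallySymmetric {d : ℕ} (ν : Measure (EuclideanSpace ℝ (Fin d))) : Prop :=
  ∀ R : EuclideanSpace ℝ (Fin d) ≃ₗᵢ[ℝ] EuclideanSpace ℝ (Fin d), ν.map R = ν

/-- The quadratic form `uᵀ A u`. -/
noncomputable def quadForm {d : ℕ} (A : Matrix (Fin d) (Fin d) ℝ)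
    (u : EuclideanSpace ℝ (Fin d)) : ℝ :=
  u.ofLp ⬝ᵥ (A *ᵥ u.ofLp)

/-- The adaptive random walk with scaling `θ`, adaptation weights `(η_n)_{n ≥ 2}`, template
proposal law `ν` and deterministic initial values `x₁`, `m₁`, `s₁`, driven by `(W_n)_{n ≥ 2}`.
All sequences are indexed by `ℕ`, but only the values with index at least `1`
(at least `2` for `η` and `W`) are constrained. Here `CFC.sqrt` of a matrix is its
positive semidefinite square root. -/
structure IsAdaptiveRandomWalk {Ω : Type*} [MeasurableSpace Ω] (P : Measure Ω) {d : ℕ}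
    (θ : ℝ) (η : ℕ → ℝ) (ν : Measure (EuclideanSpace ℝ (Fin d)))
    (x₁ m₁ : EuclideanSpace ℝ (Fin d)) (s₁ : Matrix (Fin d) (Fin d) ℝ)
    (W X M : ℕ → Ω → EuclideanSpace ℝ (Fin d))
    (S : ℕ → Ω → Matrix (Fin d) (Fin d) ℝ) : Prop where
  law_W : ∀ n, 2 ≤ n → HasLaw (W n) ν P
  indep_W : iIndepFun (fun n : ℕ => W (n + 2)) P
  init_X : ∀ᵐ ω ∂P, X 1 ω = x₁
  init_M : ∀ᵐ ω ∂P, M 1 ω = m₁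
  init_S : ∀ᵐ ω ∂P, S 1 ω = s₁
  rec_X : ∀ n, 1 ≤ n → ∀ᵐ ω ∂P,
    X (n + 1) ω = X n ω + θ • Matrix.toEuclideanLin (CFC.sqrt (S n ω)) (W (n + 1) ω)
  rec_M : ∀ n, 1 ≤ n → ∀ᵐ ω ∂P,
    M (n + 1) ω = (1 - η (n + 1)) • M n ω + η (n + 1) • X (n + 1) ω
  rec_S : ∀ n, 1 ≤ n → ∀ᵐ ω ∂P,
    S (n + 1) ω = (1 - η (n + 1)) • S n ω +
      η (n + 1) • Matrix.vecMulVec (X (n + 1) ω - M n ω).ofLp (X (n + 1) ω - M n ω).ofLp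

/-! Fix `u`, write s for uᵀSu, Y for uᵀ(X - M)/√s and Z = θ⟨v, w⟩ + Y, with v the unit vector along
S^{1/2}u, w the next innovation and e the next weight. The recursion becomes s' = s(1 + e(Z² - 1)),
while Y' is Z up to a factor 1 + O(e) for bounded Z. So log s grows unless Z lingers near 0.

Spherical symmetry rules this out: given the past, ⟨v, w⟩ is distributed as ⟨u, w⟩, hence cos(λZ)
has conditional mean φ cos(λY), where φ < 1 for a suitable λ by non-degeneracy. The sums of e(cos λZ
- φ cos λY) form an L²-bounded martingale and converge (`ae_tendsto_sum_of_integral_eq_zero`). As Y'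
≈ Z and the weights vary slowly, the sums of e cos λZ are nearly controlled too; since Z² - 1
dominates a constant minus a multiple of cos λZ (`truncated_sq_drift_bound`), log s exceeds half the
divergent sum of weights up to a bounded error (`tendsto_atTop_of_compensated_cos`). -/

/-! ### Real inequalities and the deterministic growth criterion. -/

theorem Real.sub_two_mul_sq_le_log_one_add {x : ℝ} (hx : -(1 / 2) ≤ x) :
    x - 2 * x ^ 2 ≤ Real.log (1 + x) := by
  have h0 : 0 < 1 + x := by linarith
  refine le_trans ?_ (Real.one_sub_inv_le_log_of_pos h0)
  have : 1 - (1 + x)⁻¹ - (x - 2 * x ^ 2) = x ^ 2 * (1 + 2 * x) / (1 + x) := by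
    field_simp; ring
  have h2 : 0 ≤ x ^ 2 * (1 + 2 * x) / (1 + x) :=
    div_nonneg (mul_nonneg (sq_nonneg x) (by linarith)) h0.le
  linarith

theorem one_add_mul_sq_sub_one_pos {e : ℝ} (h0 : 0 ≤ e) (h1 : e < 1) (z : ℝ) :
    0 < 1 + e * (z ^ 2 - 1) := by
  nlinarith [mul_nonneg h0 (sq_nonneg z)]

/-- This quantifies Y' ≈ Z: the root lies between 1 - e and 1 + eR², so the factor multiplying z
lies between 1 - (1 + R²)e and 1. -/
theorem abs_contraction_sub_self_le {e z R : ℝ} (h0 : 0 ≤ e) (h1 : e < 1) (hz : |z| ≤ R) :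
    |(1 - e) * z / √(1 + e * (z ^ 2 - 1)) - z| ≤ R * (1 + R ^ 2) * e := by
  have hR : 0 ≤ R := (abs_nonneg z).trans hz
  have hz2 : z ^ 2 ≤ R ^ 2 := sq_le_sq' (by linarith [neg_abs_le z]) ((le_abs_self z).trans hz)
  set q := 1 + e * (z ^ 2 - 1) with hq
  have hqpos : 0 < q := one_add_mul_sq_sub_one_pos h0 h1 z
  have hs : 0 < √q := Real.sqrt_pos.2 hqpos
  have hlow : 1 - e ≤ √q := by
    apply Real.le_sqrt_of_sq_le
    nlinarith [mul_nonneg h0 (sq_nonneg z)]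
  have hup : √q ≤ 1 + e * R ^ 2 := by
    rw [Real.sqrt_le_left (by positivity)]
    nlinarith [mul_le_mul_of_nonneg_left hz2 h0, mul_nonneg h0 (sq_nonneg R),
      sq_nonneg (e * R ^ 2)]
  have hr1 : (1 - e) / √q ≤ 1 := (div_le_one hs).2 hlow
  have hr2 : 1 - (1 + R ^ 2) * e ≤ (1 - e) / √q := by
    rw [le_div_iff₀ hs]
    by_cases hneg : 1 - (1 + R ^ 2) * e ≤ 0
    · exact (mul_nonpos_of_nonpos_of_nonneg hneg hs.le).trans (by linarith)
    · refine (mul_le_mul_of_nonneg_left hup (not_le.1 hneg).le).trans ?_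
      nlinarith [mul_nonneg h0 (sq_nonneg R), mul_nonneg (mul_nonneg h0 h0) (sq_nonneg R),
        sq_nonneg (e * R ^ 2)]
  have : (1 - e) * z / √q - z = -(z * (1 - (1 - e) / √q)) := by ring
  rw [this, abs_neg, abs_mul, abs_of_nonneg (by linarith : 0 ≤ 1 - (1 - e) / √q), mul_assoc]
  exact mul_le_mul hz (by linarith) (by linarith) hR

/-- With B(1 - φ) = 6 and |z| ≤ R, replacing the second cosine by cos λz costs at most 1, leaving 2
- 6 cos λz. For |z| ≤ 3, λ ≤ 1/3 makes the cosine at least 1/2, so this is at most -1; for |z| ≥ 3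
it is at most 8 = 3² - 1. Beyond R the crude bound 1 + 2B is enough. Truncating at R keeps the
quadratic error of the logarithm summable. -/
theorem truncated_sq_drift_bound {φ lam : ℝ} (hφ : φ < 1) (hφ' : -1 ≤ φ) (hlam : 0 < lam)
    (hlam' : lam ≤ 1 / 3) {B R e z : ℝ} (hB : B = 6 / (1 - φ)) (hR : R = 3 + 2 * B)
    (h0 : 0 ≤ e) (h1 : e < 1) (he : B * (R * (1 + R ^ 2) * e) ≤ 1) :
    1 - B * (Real.cos (lam * z) -
      φ * Real.cos (lam * ((1 - e) * z / √(1 + e * (z ^ 2 - 1))))) ≤ min (z ^ 2) (R ^ 2) - 1 := by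
  have hφ0 : 0 < 1 - φ := by linarith
  have hBφ : B * (1 - φ) = 6 := by rw [hB]; field_simp
  have hB3 : 3 ≤ B := by rw [hB, le_div_iff₀ hφ0]; linarith
  have hR9 : 9 ≤ R := by linarith
  set C := Real.cos (lam * z) with hC
  set D := Real.cos (lam * ((1 - e) * z / √(1 + e * (z ^ 2 - 1)))) with hD
  have hC1 : -1 ≤ C := Real.neg_one_le_cos _
  have habs : |φ| ≤ 1 := abs_le.2 ⟨hφ', hφ.le⟩
  have hD1 : |φ * D| ≤ 1 := by
    rw [abs_mul]; exact mul_le_one₀ habs (abs_nonneg _) (Real.abs_cos_le_one _)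
  by_cases hz : |z| ≤ R
  · have hmin : min (z ^ 2) (R ^ 2) = z ^ 2 :=
      min_eq_left (sq_le_sq' (by linarith [neg_abs_le z]) ((le_abs_self z).trans hz))
    have hCD : |D - C| ≤ R * (1 + R ^ 2) * e := by
      refine (Real.abs_cos_sub_cos_le _ _).trans ?_
      rw [← mul_sub, abs_mul, abs_of_pos hlam]
      have := abs_contraction_sub_self_le h0 h1 hz
      nlinarith [abs_nonneg ((1 - e) * z / √(1 + e * (z ^ 2 - 1)) - z)]
    have h2 : φ * (D - C) ≤ R * (1 + R ^ 2) * e := by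
      refine (le_abs_self _).trans ?_
      rw [abs_mul]
      exact (mul_le_of_le_one_left (abs_nonneg _) habs).trans hCD
    have h3 : B * (φ * (D - C)) ≤ 1 :=
      (mul_le_mul_of_nonneg_left h2 (by linarith)).trans he
    have h4 : B * (C - φ * D) = 6 * C - B * (φ * (D - C)) := by
      linear_combination C * hBφ
    rw [hmin, h4]
    by_cases hz3 : |z| ≤ 3
    · have hC2 : 1 - (lam * z) ^ 2 / 2 ≤ C := Real.one_sub_sq_div_two_le_cos
      have : (lam * z) ^ 2 ≤ 1 := by
        rw [sq_le_one_iff_abs_le_one, abs_mul, abs_of_pos hlam]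
        nlinarith [abs_nonneg z]
      nlinarith [sq_nonneg z]
    · have : 9 ≤ z ^ 2 := by rw [← sq_abs]; nlinarith [not_le.1 hz3]
      linarith
  · have hz2 : R ^ 2 ≤ z ^ 2 := by rw [← sq_abs z]; nlinarith [not_le.1 hz]
    rw [min_eq_right hz2]
    have : -2 ≤ C - φ * D := by linarith [(abs_le.1 hD1).2]
    nlinarith

/-- The pathwise growth criterion: convergence of the compensated cosine sums forces `s n → ∞`. -/
theorem tendsto_atTop_of_compensated_cos {e s Z Y : ℕ → ℝ} {φ lam c : ℝ}
    (he : ∀ n, 0 < e n ∧ e n < 1) (hratio : Tendsto (fun n => e (n + 1) / e n) atTop (𝓝 1))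
    (hdiv : Tendsto (fun n => ∑ i ∈ Finset.range n, e i) atTop atTop)
    (hsq : Summable fun n => e n ^ 2)
    (hs0 : 0 < s 0) (hs : ∀ n, s (n + 1) = s n * (1 + e n * (Z n ^ 2 - 1)))
    (hY : ∀ n, Y (n + 1) = (1 - e n) * Z n / √(1 + e n * (Z n ^ 2 - 1)))
    (hφ : φ < 1) (hφ' : -1 ≤ φ) (hlam : 0 < lam) (hlam' : lam ≤ 1 / 3)
    (hN : Tendsto (fun n => ∑ i ∈ Finset.range n,
      e i * (Real.cos (lam * Z i) - φ * Real.cos (lam * Y i))) atTop (𝓝 c)) :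
    Tendsto s atTop atTop := by
  obtain ⟨B, hB⟩ : ∃ B, B = 6 / (1 - φ) := ⟨_, rfl⟩
  obtain ⟨R, hR⟩ : ∃ R, R = 3 + 2 * B := ⟨_, rfl⟩
  have hφ0 : 0 < 1 - φ := by linarith
  have hB3 : 3 ≤ B := by rw [hB, le_div_iff₀ hφ0]; linarith
  have hR9 : 9 ≤ R := by linarith
  have hspos : ∀ n, 0 < s n := by
    intro n
    induction n with
    | zero => exact hs0
    | succ n ih =>
      rw [hs]; exact mul_pos ih (one_add_mul_sq_sub_one_pos (he n).1.le (he n).2 _)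
  have hezero : Tendsto e atTop (𝓝 0) := by
    have h1 := hsq.tendsto_atTop_zero
    have h2 := (Real.continuous_sqrt.tendsto 0).comp h1
    simp only [Real.sqrt_zero] at h2
    refine h2.congr fun n => ?_
    simp [Real.sqrt_sq (he n).1.le]
  set N : ℕ → ℝ := fun n => ∑ i ∈ Finset.range n,
      e i * (Real.cos (lam * Z i) - φ * Real.cos (lam * Y i)) with hNdef
  -- A Lyapunov function. Taking `N (n + 1)` rather than `N n` lets the term in cos λZ at n + 1
  -- cancel in the increment, so cos λY at n + 1 is paired with cos λZ at n, as the drift bound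
  -- requires.
  set Φ : ℕ → ℝ := fun n => Real.log (s n) - B * (e n * Real.cos (lam * Z n)) + B * N (n + 1)
    - 1 / 2 * ∑ i ∈ Finset.range n, e i + 2 * R ^ 4 * ∑ i ∈ Finset.range n, e i ^ 2 with hΦ
  have hev1 : ∀ᶠ n in atTop, B * (R * (1 + R ^ 2) * e n) ≤ 1 := by
    have : Tendsto (fun n => B * (R * (1 + R ^ 2) * e n)) atTop (𝓝 (B * (R * (1 + R ^ 2) * 0))) :=
      (hezero.const_mul _).const_mul _
    rw [mul_zero, mul_zero] at this
    exact this.eventually_le_const one_pos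
  have hev2 : ∀ᶠ n in atTop, B * |e (n + 1) - e n| ≤ e n / 2 := by
    have h1 : Tendsto (fun n => B * |e (n + 1) / e n - 1|) atTop (𝓝 (B * |1 - 1|)) :=
      ((hratio.sub_const 1).abs).const_mul _
    rw [sub_self, abs_zero, mul_zero] at h1
    filter_upwards [h1.eventually_le_const (by norm_num : (0 : ℝ) < 1 / 2)] with n hn
    have hen := (he n).1
    have : e (n + 1) - e n = (e (n + 1) / e n - 1) * e n := by field_simp
    rw [this, abs_mul, abs_of_pos hen, ← mul_assoc]
    nlinarith
  have hev3 : ∀ᶠ n in atTop, e n ≤ 1 / 2 := hezero.eventually_le_const (by norm_num)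
  obtain ⟨J, hJ⟩ := (hev1.and (hev2.and hev3)).exists_forall_of_atTop
  have hmono : ∀ n, J ≤ n → Φ n ≤ Φ (n + 1) := by
    intro n hn
    obtain ⟨h1, h2, h3⟩ := hJ n hn
    obtain ⟨hen, hen1⟩ := he n
    have hdrift := truncated_sq_drift_bound hφ hφ' hlam hlam' (z := Z n) hB hR hen.le hen1 h1
    rw [← hY] at hdrift
    have hmin0 : 0 ≤ min (Z n ^ 2) (R ^ 2) := le_min (sq_nonneg _) (sq_nonneg _)
    have hminR : min (Z n ^ 2) (R ^ 2) ≤ R ^ 2 := min_le_right _ _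
    have hminZ : min (Z n ^ 2) (R ^ 2) ≤ Z n ^ 2 := min_le_left _ _
    generalize min (Z n ^ 2) (R ^ 2) = f at hdrift hmin0 hminR hminZ
    have hlog : Real.log (s (n + 1)) = Real.log (s n) + Real.log (1 + e n * (Z n ^ 2 - 1)) := by
      rw [hs, Real.log_mul (hspos n).ne' (one_add_mul_sq_sub_one_pos hen.le hen1 _).ne']
    -- `e n ≤ 1 / 2` and `f ≥ 0` keep the argument above -1/2.
    have hlow : e n * (f - 1) - 2 * (e n * (f - 1)) ^ 2 ≤ Real.log (1 + e n * (f - 1)) :=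
      Real.sub_two_mul_sq_le_log_one_add (by nlinarith)
    have hle : Real.log (1 + e n * (f - 1)) ≤ Real.log (1 + e n * (Z n ^ 2 - 1)) := by
      apply Real.log_le_log (by nlinarith)
      nlinarith
    have hsq' : (e n * (f - 1)) ^ 2 ≤ R ^ 4 * e n ^ 2 := by
      have : (f - 1) ^ 2 ≤ (R ^ 2) ^ 2 := sq_le_sq' (by nlinarith) (by linarith)
      rw [mul_pow, mul_comm, show R ^ 4 = (R ^ 2) ^ 2 by ring]
      exact mul_le_mul_of_nonneg_right this (sq_nonneg _)
    have hd2 := mul_le_mul_of_nonneg_left hdrift hen.le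
    have hN1 : N (n + 2) = N (n + 1) + e (n + 1) * (Real.cos (lam * Z (n + 1)) -
        φ * Real.cos (lam * Y (n + 1))) := Finset.sum_range_succ _ _
    -- The cost of the weight changing from `e n` to `e (n + 1)`: it consumes half of the unit
    -- drift, and the other half is subtracted in `Φ`.
    have hrem : B * (φ * (e (n + 1) - e n) * Real.cos (lam * Y (n + 1))) ≤ e n / 2 := by
      refine le_trans ?_ h2
      refine mul_le_mul_of_nonneg_left ((le_abs_self _).trans ?_) (by linarith)
      rw [abs_mul, abs_mul]
      have hφa : |φ| ≤ 1 := abs_le.2 ⟨hφ', hφ.le⟩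
      exact (mul_le_of_le_one_right (by positivity) (Real.abs_cos_le_one _)).trans
        (mul_le_of_le_one_left (abs_nonneg _) hφa)
    simp only [hΦ, Finset.sum_range_succ _ n, show n + 1 + 1 = n + 2 from rfl, hN1, hlog]
    linarith
  have hΦJ : ∀ n, J ≤ n → Φ J ≤ Φ n := by
    intro n hn
    induction n, hn using Nat.le_induction with
    | base => exact le_rfl
    | succ n hn ih => exact ih.trans (hmono n hn)
  have hNb := (hN.comp (tendsto_add_atTop_nat 1))
  have hlogtop : Tendsto (fun n => Real.log (s n)) atTop atTop := by
    have hsum := hsq.tendsto_sum_tsum_nat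
    have hcos : Tendsto (fun n => e n * Real.cos (lam * Z n)) atTop (𝓝 0) :=
      squeeze_zero_norm (fun n => by
        rw [Real.norm_eq_abs, abs_mul, abs_of_pos (he n).1]
        exact mul_le_of_le_one_right (he n).1.le (Real.abs_cos_le_one _)) hezero
    have hconv := (((hcos.const_mul B).sub (hNb.const_mul B)).sub
      (hsum.const_mul (2 * R ^ 4))).const_add (Φ J)
    have htop := hconv.add_atTop (hdiv.const_mul_atTop (by norm_num : (0 : ℝ) < 1 / 2))
    refine tendsto_atTop_mono' _ ?_ htop
    filter_upwards [eventually_ge_atTop J] with n hn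
    have := hΦJ n hn
    simp only [hΦ, Function.comp_apply] at this ⊢
    linarith
  exact (Real.tendsto_exp_atTop.comp hlogtop).congr fun n => Real.exp_log (hspos n)

/-! ### Continuity and measurability of the matrix square root. -/

section
-- This norm supplies the C⋆-algebra structure behind continuity of the square root.
open scoped Matrix.Norms.L2Operator

theorem Matrix.continuousOn_cfcSqrt {n : Type*} [Fintype n] [DecidableEq n] :
    ContinuousOn (CFC.sqrt : Matrix n n ℝ → Matrix n n ℝ) {A | 0 ≤ A} :=
  CFC.continuousOn_sqrt
end

theorem Matrix.isClosed_nonneg {n : Type*} [Fintype n] [DecidableEq n] :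
    IsClosed {A : Matrix n n ℝ | 0 ≤ A} := by
  have : {A : Matrix n n ℝ | 0 ≤ A} =
      {A | Aᴴ = A} ∩ ⋂ x : n → ℝ, {A | 0 ≤ star x ⬝ᵥ (A *ᵥ x)} := by
    ext A
    simp [Matrix.nonneg_iff_posSemidef, Matrix.posSemidef_iff_dotProduct_mulVec, Matrix.IsHermitian]
  rw [this]
  refine (isClosed_eq (by fun_prop) continuous_id).inter (isClosed_iInter fun x => ?_)
  exact isClosed_le continuous_const (by fun_prop)

theorem Matrix.measurable_cfcSqrt_apply {n Ω : Type*} [Fintype n] [DecidableEq n]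
    [MeasurableSpace Ω] {A : Ω → Matrix n n ℝ} (hA : ∀ i j, Measurable fun ω => A ω i j) (i j : n) :
    Measurable fun ω => CFC.sqrt (A ω) i j := by
  let _ : MeasurableSpace (Matrix n n ℝ) := inferInstanceAs (MeasurableSpace (n → n → ℝ))
  have _ : BorelSpace (Matrix n n ℝ) := inferInstanceAs (BorelSpace (n → n → ℝ))
  have hAm : Measurable A := measurable_pi_iff.2 fun i => measurable_pi_iff.2 fun j => hA i j
  have hs : Measurable (CFC.sqrt : Matrix n n ℝ → Matrix n n ℝ) := by
    classical
    have h := (Matrix.continuousOn_cfcSqrt (n := n)).measurable_piecewise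
      (g := fun _ => (0 : Matrix n n ℝ)) continuousOn_const Matrix.isClosed_nonneg.measurableSet
    convert h using 1
    funext A
    by_cases hA : 0 ≤ A
    · simp [Set.piecewise, hA]
    · simp [Set.piecewise, hA, CFC.sqrt_of_not_nonneg hA]
  have h2 := hs.comp hAm
  exact (measurable_pi_apply j).comp ((measurable_pi_apply i).comp h2)

/-! ### Quadratic forms and rank-one updates. -/

section Algebra

variable {d : ℕ}

theorem inner_toEuclideanLin_cfcSqrt (A : Matrix (Fin d) (Fin d) ℝ)
    (x y : EuclideanSpace ℝ (Fin d)) :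
    inner ℝ x (Matrix.toEuclideanLin (CFC.sqrt A) y) =
      inner ℝ (Matrix.toEuclideanLin (CFC.sqrt A) x) y := by
  have h : (CFC.sqrt A).IsHermitian := 
    (Matrix.nonneg_iff_posSemidef.1 (CFC.sqrt_nonneg A)).isHermitian
  exact ((Matrix.isSymmetric_toEuclideanLin_iff.2 h) x y).symm

theorem norm_sq_toEuclideanLin_cfcSqrt {A : Matrix (Fin d) (Fin d) ℝ} (hA : A.PosSemidef)
    (u : EuclideanSpace ℝ (Fin d)) :
    ‖Matrix.toEuclideanLin (CFC.sqrt A) u‖ ^ 2 = quadForm A u := by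
  have hA' : 0 ≤ A := hA.nonneg
  rw [← real_inner_self_eq_norm_sq, ← inner_toEuclideanLin_cfcSqrt]
  have : Matrix.toEuclideanLin (CFC.sqrt A) (Matrix.toEuclideanLin (CFC.sqrt A) u) =
      Matrix.toEuclideanLin A u := by
    conv_rhs => rw [← CFC.sqrt_mul_sqrt_self A]
    simp [Matrix.toLpLin_apply, Matrix.mulVec_mulVec]
  rw [this]
  simp [quadForm, Matrix.toLpLin_apply, EuclideanSpace.inner_eq_star_dotProduct, dotProduct_comm]

theorem quadForm_pos {A : Matrix (Fin d) (Fin d) ℝ} (hA : A.PosDef)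
    {u : EuclideanSpace ℝ (Fin d)} (hu : u ≠ 0) : 0 < quadForm A u := by
  have : u.ofLp ≠ 0 := fun h => hu (by ext i; simp [h])
  simpa [quadForm] using hA.dotProduct_mulVec_pos this

theorem quadForm_smul_add_smul_vecMulVec (a b : ℝ) (A : Matrix (Fin d) (Fin d) ℝ)
    (y u : EuclideanSpace ℝ (Fin d)) :
    quadForm (a • A + b • Matrix.vecMulVec y.ofLp y.ofLp) u =
      a * quadForm A u + b * inner ℝ u y ^ 2 := by
  simp [quadForm, Matrix.add_mulVec, Matrix.smul_mulVec, Matrix.vecMulVec_mulVec,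
    EuclideanSpace.inner_eq_star_dotProduct, dotProduct_comm]
  left
  ring

theorem posDef_smul_add_smul_vecMulVec {e : ℝ} (h0 : 0 ≤ e) (h1 : e < 1)
    {A : Matrix (Fin d) (Fin d) ℝ} (hA : A.PosDef) (y : Fin d → ℝ) :
    ((1 - e) • A + e • Matrix.vecMulVec y y).PosDef := by
  refine (hA.smul (sub_pos.2 h1)).add_posSemidef (Matrix.PosSemidef.smul ?_ h0)
  simpa using Matrix.posSemidef_vecMulVec_self_star y

end Algebra

/-! ### Reduction of the walk to scalar recursions in direction `u`. -/

section State

variable {d : ℕ}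

/-- One step of the adaptive random walk recursion for the triple `(X, M, S)`. -/
noncomputable def walkStep (θ e : ℝ)
    (q : EuclideanSpace ℝ (Fin d) × EuclideanSpace ℝ (Fin d) × Matrix (Fin d) (Fin d) ℝ)
    (w : EuclideanSpace ℝ (Fin d)) :
    EuclideanSpace ℝ (Fin d) × EuclideanSpace ℝ (Fin d) × Matrix (Fin d) (Fin d) ℝ :=
  let x := q.1 + θ • Matrix.toEuclideanLin (CFC.sqrt q.2.2) w
  (x, (1 - e) • q.2.1 + e • x,
    (1 - e) • q.2.2 + e • Matrix.vecMulVec (x - q.2.1).ofLp (x - q.2.1).ofLp)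

/-- The trajectory `(X, M, S)` as a function of the initial state and of the innovations. -/
noncomputable def walkState (θ : ℝ) (e : ℕ → ℝ)
    (q₀ : EuclideanSpace ℝ (Fin d) × EuclideanSpace ℝ (Fin d) × Matrix (Fin d) (Fin d) ℝ)
    (w : ℕ → EuclideanSpace ℝ (Fin d)) :
    ℕ → EuclideanSpace ℝ (Fin d) × EuclideanSpace ℝ (Fin d) × Matrix (Fin d) (Fin d) ℝ
  | 0 => q₀
  | n + 1 => walkStep θ (e n) (walkState θ e q₀ w n) (w n)

/-- The normalised displacement `uᵀ(X - M) / (uᵀSu)^{1/2}` of a state. -/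
noncomputable def normDisp
    (q : EuclideanSpace ℝ (Fin d) × EuclideanSpace ℝ (Fin d) × Matrix (Fin d) (Fin d) ℝ)
    (u : EuclideanSpace ℝ (Fin d)) : ℝ :=
  inner ℝ u (q.1 - q.2.1) / √(quadForm q.2.2 u)

/-- The direction of `S^{1/2} u`. -/
noncomputable def sqrtDir
    (q : EuclideanSpace ℝ (Fin d) × EuclideanSpace ℝ (Fin d) × Matrix (Fin d) (Fin d) ℝ)
    (u : EuclideanSpace ℝ (Fin d)) : EuclideanSpace ℝ (Fin d) :=
  (√(quadForm q.2.2 u))⁻¹ • Matrix.toEuclideanLin (CFC.sqrt q.2.2) u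

variable {θ : ℝ} {e : ℕ → ℝ}
  {q₀ q : EuclideanSpace ℝ (Fin d) × EuclideanSpace ℝ (Fin d) × Matrix (Fin d) (Fin d) ℝ}
  {u : EuclideanSpace ℝ (Fin d)}

theorem walkState_posDef (he : ∀ n, 0 < e n ∧ e n < 1) (hq : q₀.2.2.PosDef)
    (w : ℕ → EuclideanSpace ℝ (Fin d)) (n : ℕ) : (walkState θ e q₀ w n).2.2.PosDef := by
  induction n with
  | zero => exact hq
  | succ n ih => exact posDef_smul_add_smul_vecMulVec (he n).1.le (he n).2 ih _

/-- Unit length is what lets spherical symmetry erase the dependence on the random matrix. -/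
theorem norm_sqrtDir (hq : q.2.2.PosDef) (hu : u ≠ 0) : ‖sqrtDir q u‖ = 1 := by
  have h := quadForm_pos hq hu
  have h2 : ‖Matrix.toEuclideanLin (CFC.sqrt q.2.2) u‖ = √(quadForm q.2.2 u) := by
    rw [← norm_sq_toEuclideanLin_cfcSqrt hq.posSemidef, Real.sqrt_sq (norm_nonneg _)]
  rw [sqrtDir, norm_smul, h2, norm_inv, Real.norm_of_nonneg (Real.sqrt_nonneg _),
    inv_mul_cancel₀ (Real.sqrt_pos.2 h).ne']

theorem inner_walkStep_fst_sub (ε : ℝ) (hq : q.2.2.PosDef) (hu : u ≠ 0)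
    (w : EuclideanSpace ℝ (Fin d)) :
    inner ℝ u ((walkStep θ ε q w).1 - q.2.1) =
      √(quadForm q.2.2 u) * (θ * inner ℝ (sqrtDir q u) w + normDisp q u) := by
  have h := (Real.sqrt_pos.2 (quadForm_pos hq hu)).ne'
  simp only [walkStep, sqrtDir, normDisp, add_sub_right_comm, inner_add_right, inner_smul_right,
    inner_toEuclideanLin_cfcSqrt, real_inner_smul_left]
  field_simp
  ring

theorem quadForm_walkStep (ε : ℝ) (hq : q.2.2.PosDef) (hu : u ≠ 0)
    (w : EuclideanSpace ℝ (Fin d)) :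
    quadForm (walkStep θ ε q w).2.2 u = quadForm q.2.2 u *
      (1 + ε * ((θ * inner ℝ (sqrtDir q u) w + normDisp q u) ^ 2 - 1)) := by
  have h := inner_walkStep_fst_sub (θ := θ) ε hq hu w
  have h2 : quadForm (walkStep θ ε q w).2.2 u = (1 - ε) * quadForm q.2.2 u +
      ε * inner ℝ u ((walkStep θ ε q w).1 - q.2.1) ^ 2 :=
    quadForm_smul_add_smul_vecMulVec _ _ _ _ _
  rw [h2, h, mul_pow, Real.sq_sqrt (quadForm_pos hq hu).le]
  ring

theorem normDisp_walkStep (ε : ℝ) (hq : q.2.2.PosDef) (hu : u ≠ 0)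
    (w : EuclideanSpace ℝ (Fin d)) :
    normDisp (walkStep θ ε q w) u = (1 - ε) * (θ * inner ℝ (sqrtDir q u) w + normDisp q u) /
      √(1 + ε * ((θ * inner ℝ (sqrtDir q u) w + normDisp q u) ^ 2 - 1)) := by
  have h := inner_walkStep_fst_sub (θ := θ) ε hq hu w
  have hpos := (Real.sqrt_pos.2 (quadForm_pos hq hu)).ne'
  have hx : (walkStep θ ε q w).1 - (walkStep θ ε q w).2.1 =
      (1 - ε) • ((walkStep θ ε q w).1 - q.2.1) := by
    simp only [walkStep]
    module
  conv_lhs => rw [normDisp]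
  rw [hx, inner_smul_right, h, quadForm_walkStep ε hq hu,
    Real.sqrt_mul (quadForm_pos hq hu).le]
  generalize √(quadForm q.2.2 u) = σ at hpos
  generalize θ * inner ℝ (sqrtDir q u) w + normDisp q u = z
  rw [mul_left_comm, mul_div_mul_left _ _ hpos]

end State

/-! ### Measurability of the trajectory. -/

section Measurability

variable {d : ℕ} {Ω : Type*} [MeasurableSpace Ω]

theorem measurable_toEuclideanLin_apply {A : Ω → Matrix (Fin d) (Fin d) ℝ}
    {x : Ω → EuclideanSpace ℝ (Fin d)} (hA : ∀ i j, Measurable fun ω => A ω i j)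
    (hx : Measurable x) : Measurable fun ω => Matrix.toEuclideanLin (A ω) (x ω) := by
  have hx' : ∀ j, Measurable fun ω => (x ω).ofLp j := fun j => by fun_prop
  refine (WithLp.measurable_toLp 2 _).comp (measurable_pi_iff.2 fun i => ?_)
  change Measurable fun ω => ∑ j, A ω i j * (x ω).ofLp j
  exact Finset.measurable_sum _ fun j _ => (hA i j).mul (hx' j)

theorem measurable_quadForm {A : Ω → Matrix (Fin d) (Fin d) ℝ}
    (hA : ∀ i j, Measurable fun ω => A ω i j) (u : EuclideanSpace ℝ (Fin d)) :
    Measurable fun ω => quadForm (A ω) u := by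
  simp only [quadForm, Matrix.mulVec, dotProduct]
  exact Finset.measurable_sum _ fun i _ => measurable_const.mul
    (Finset.measurable_sum _ fun j _ => (hA i j).mul measurable_const)

/-- Only innovations of index below `n` enter. With a σ-algebra of the natural filtration in place
of the ambient one, this gives predictability. -/
theorem measurable_walkState {θ : ℝ} {e : ℕ → ℝ}
    {q₀ : EuclideanSpace ℝ (Fin d) × EuclideanSpace ℝ (Fin d) × Matrix (Fin d) (Fin d) ℝ}
    {w : ℕ → Ω → EuclideanSpace ℝ (Fin d)} (n : ℕ) (hw : ∀ k < n, Measurable (w k)) :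
    Measurable (fun ω => (walkState θ e q₀ (w · ω) n).1) ∧
    Measurable (fun ω => (walkState θ e q₀ (w · ω) n).2.1) ∧
    ∀ i j, Measurable (fun ω => (walkState θ e q₀ (w · ω) n).2.2 i j) := by
  induction n with
  | zero =>
    simp only [walkState]
    exact ⟨measurable_const, measurable_const, fun _ _ => measurable_const⟩
  | succ n ih =>
    obtain ⟨h1, h2, h3⟩ := ih fun k hk => hw k (by omega)
    have hx : Measurable (fun ω => (walkState θ e q₀ (w · ω) (n + 1)).1) :=
      h1.add ((measurable_toEuclideanLin_apply (Matrix.measurable_cfcSqrt_apply h3)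
        (hw n (by omega))).const_smul θ)
    have hM : Measurable (fun ω => (walkState θ e q₀ (w · ω) (n + 1)).2.1) :=
      (h2.const_smul (1 - e n)).add (hx.const_smul (e n))
    refine ⟨hx, hM, fun i j => ?_⟩
    have hd := hx.sub h2
    have hd' : ∀ j, Measurable fun ω => ((walkState θ e q₀ (w · ω) (n + 1)).1 -
      (walkState θ e q₀ (w · ω) n).2.1).ofLp j := fun j => by fun_prop
    exact ((h3 i j).const_mul (1 - e n)).add (((hd' i).mul (hd' j)).const_mul (e n))

theorem measurable_sqrtDir_normDisp
    {q : Ω → EuclideanSpace ℝ (Fin d) × EuclideanSpace ℝ (Fin d) × Matrix (Fin d) (Fin d) ℝ}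
    (h1 : Measurable fun ω => (q ω).1) (h2 : Measurable fun ω => (q ω).2.1)
    (h3 : ∀ i j, Measurable fun ω => (q ω).2.2 i j) (u : EuclideanSpace ℝ (Fin d)) :
    Measurable fun ω => (sqrtDir (q ω) u, normDisp (q ω) u) := by
  have hs := (measurable_quadForm h3 u).sqrt
  refine Measurable.prodMk ?_ ?_
  · exact hs.inv.smul (measurable_toEuclideanLin_apply (Matrix.measurable_cfcSqrt_apply h3)
      measurable_const)
  · exact (measurable_const.inner (h1.sub h2)).div hs

end Measurability

/-! ### Convergence of weighted sums of centred bounded functions. -/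

section Martingale

variable {Ω α β : Type*} [MeasurableSpace Ω] {P : Measure Ω} [IsProbabilityMeasure P]
  [MeasurableSpace α] [MeasurableSpace β] {ν : Measure β}

/-- Conditional centring tested against a past variable `T`: by independence the joint law is a
product, and Fubini integrates `w` out first, with `a` frozen. -/
theorem integral_mul_eq_zero_of_indepFun {T : Ω → ℝ} {a : Ω → α} {w : Ω → β}
    {k : α × β → ℝ} {C K : ℝ} (hT : Measurable T) (hTC : ∀ ω, |T ω| ≤ C) (ha : Measurable a)
    (hw : Measurable w) (hlaw : P.map w = ν) (hind : IndepFun (fun ω => (T ω, a ω)) w P)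
    (hk : Measurable k) (hkK : ∀ p, |k p| ≤ K) (hk0 : ∀ᵐ ω ∂P, ∫ x, k (a ω, x) ∂ν = 0) :
    ∫ ω, T ω * k (a ω, w ω) ∂P = 0 := by
  have hTa : Measurable fun ω => (T ω, a ω) := hT.prodMk ha
  have hν : IsProbabilityMeasure ν := hlaw ▸ Measure.isProbabilityMeasure_map hw.aemeasurable
  have hμ : IsProbabilityMeasure (P.map fun ω => (T ω, a ω)) :=
    Measure.isProbabilityMeasure_map hTa.aemeasurable
  have hprod := (indepFun_iff_map_prod_eq_prod_map_map hTa.aemeasurable hw.aemeasurable).1 hind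
  rw [hlaw] at hprod
  have hF : Measurable fun p : (ℝ × α) × β => p.1.1 * k (p.1.2, p.2) := by fun_prop
  have hint : Integrable (fun p : (ℝ × α) × β => p.1.1 * k (p.1.2, p.2))
      ((P.map fun ω => (T ω, a ω)).prod ν) := by
    rw [← hprod, integrable_map_measure hF.aestronglyMeasurable (hTa.prodMk hw).aemeasurable]
    refine Integrable.of_bound (by fun_prop) (C * K) (ae_of_all _ fun ω => ?_)
    simp only [Function.comp, norm_mul, Real.norm_eq_abs]
    exact mul_le_mul (hTC ω) (hkK _) (abs_nonneg _) ((abs_nonneg _).trans (hTC ω))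
  have h1 : ∫ ω, T ω * k (a ω, w ω) ∂P = ∫ p, p.1.1 * k (p.1.2, p.2)
      ∂(P.map fun ω => ((T ω, a ω), w ω)) :=
    (integral_map (hTa.prodMk hw).aemeasurable hF.aestronglyMeasurable).symm
  rw [h1, hprod, integral_prod _ hint, integral_map hTa.aemeasurable
    hint.integral_prod_left.aestronglyMeasurable]
  simp only [integral_const_mul]
  exact integral_eq_zero_of_ae (hk0.mono fun ω h => by simp [h])

theorem ae_tendsto_sum_of_integral_eq_zero {β : Type*} [NormedAddCommGroup β] [MeasurableSpace β]
    [BorelSpace β] {ν : Measure β} {w : ℕ → Ω → β} (hw : ∀ n, StronglyMeasurable (w n))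
    (hlaw : ∀ n, P.map (w n) = ν) (hind : iIndepFun w P)
    {a : ℕ → Ω → α} (ha0 : Measurable[Filtration.natural w hw 0] (a 0))
    (ha : ∀ n, Measurable[Filtration.natural w hw n] (a (n + 1)))
    {k : α × β → ℝ} {K : ℝ} (hk : Measurable k) (hkK : ∀ p, |k p| ≤ K)
    (hk0 : ∀ n ω, ∫ x, k (a n ω, x) ∂ν = 0) {e : ℕ → ℝ} (he : Summable fun n => e n ^ 2) :
    ∀ᵐ ω ∂P, ∃ c, Tendsto (fun n => ∑ i ∈ Finset.range n, e i * k (a i ω, w i ω)) atTop (𝓝 c) := by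
  set G := Filtration.natural w hw with hG
  set N : ℕ → Ω → ℝ := fun n ω => ∑ i ∈ Finset.range (n + 1), e i * k (a i ω, w i ω) with hN
  have hwG : ∀ i n, i ≤ n → Measurable[G n] (w i) := fun i n hin =>
    ((Filtration.stronglyAdapted_natural hw i).mono (G.mono hin)).measurable
  have haG : ∀ i n, i ≤ n → Measurable[G n] (a i) := by
    intro i n hin
    cases i with
    | zero => exact ha0.mono (G.mono hin) le_rfl
    | succ i => exact (ha i).mono (G.mono (by omega)) le_rfl
  have hNG : ∀ n, Measurable[G n] (N n) := fun n =>
    Finset.measurable_sum _ fun i hi => by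
      have hi' : i ≤ n := Nat.lt_succ_iff.1 (Finset.mem_range.1 hi)
      exact (hk.comp ((haG i n hi').prodMk (hwG i n hi'))).const_mul (e i)
  have hNm : ∀ n, Measurable (N n) := fun n => (hNG n).mono (G.le n) le_rfl
  have ham : ∀ n, Measurable (a n) := fun n => (haG n n le_rfl).mono (G.le n) le_rfl
  have hNb : ∀ n ω, |N n ω| ≤ ∑ i ∈ Finset.range (n + 1), |e i| * K := fun n ω =>
    (Finset.abs_sum_le_sum_abs _ _).trans (Finset.sum_le_sum fun i _ => by
      rw [abs_mul]; exact mul_le_mul_of_nonneg_left (hkK _) (abs_nonneg _))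
  have hNi : ∀ n, Integrable (N n) P := fun n =>
    Integrable.of_bound (hNm n).aestronglyMeasurable _ (ae_of_all _ (hNb n))
  -- Used twice: with indicators for the martingale property, and with `T = N n` to kill the cross
  -- term in the second moment.
  have horth : ∀ n (T : Ω → ℝ) (C : ℝ), Measurable[G n] T → (∀ ω, |T ω| ≤ C) →
      ∫ ω, T ω * k (a (n + 1) ω, w (n + 1) ω) ∂P = 0 := by
    intro n T C hT hTC
    refine integral_mul_eq_zero_of_indepFun (hT.mono (G.le n) le_rfl) hTC (ham _)
      (hw _).measurable (hlaw _) ?_ hk hkK (ae_of_all _ (hk0 _))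
    rw [IndepFun_iff_Indep]
    exact indep_of_indep_of_le_left
      (hind.indep_comap_natural_of_lt hw (Nat.lt_succ_self n)).symm
      (hT.prodMk (ha n)).comap_le
  have hsucc : ∀ n ω, N (n + 1) ω = N n ω + e (n + 1) * k (a (n + 1) ω, w (n + 1) ω) :=
    fun n ω => Finset.sum_range_succ _ _
  have hkm : ∀ n, Measurable fun ω => k (a n ω, w n ω) := fun n =>
    hk.comp ((ham n).prodMk (hw n).measurable)
  have hki : ∀ n, Integrable (fun ω => k (a n ω, w n ω)) P := fun n =>
    Integrable.of_bound (hkm n).aestronglyMeasurable K (ae_of_all _ fun _ => hkK _)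
  have hmart : Martingale N G P := by
    refine martingale_of_setIntegral_eq_succ (fun n => (hNG n).stronglyMeasurable) hNi
      fun n s hs => ?_
    simp only [hsucc]
    rw [integral_add (hNi n).integrableOn ((hki _).const_mul _).integrableOn, integral_const_mul]
    have h := horth n (s.indicator fun _ => 1) 1
      ((@measurable_const ℝ Ω _ (G n) 1).indicator hs) (fun ω => by
      by_cases h : ω ∈ s <;> simp [h])
    have h2 : ∫ ω in s, k (a (n + 1) ω, w (n + 1) ω) ∂P = 0 := by
      rw [← integral_indicator (G.le n s hs), ← h]
      refine integral_congr_ae (ae_of_all _ fun ω => ?_)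
      by_cases h : ω ∈ s <;> simp [h]
    rw [h2, mul_zero, add_zero]
  have hsqint : ∀ n, Integrable (fun ω => N n ω ^ 2) P := fun n =>
    Integrable.of_bound ((hNm n).pow_const 2).aestronglyMeasurable
      ((∑ i ∈ Finset.range (n + 1), |e i| * K) ^ 2) (ae_of_all _ fun ω => by
        rw [norm_pow]; exact pow_le_pow_left₀ (norm_nonneg _) (hNb n ω) 2)
  have hk2 : ∀ n, ∫ ω, k (a n ω, w n ω) ^ 2 ∂P ≤ K ^ 2 := fun n => by
    have h2 := norm_integral_le_of_norm_le_const (μ := P) (f := fun ω => k (a n ω, w n ω) ^ 2)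
      (C := K ^ 2) (ae_of_all _ fun ω => by
        rw [norm_pow]; exact pow_le_pow_left₀ (norm_nonneg _) (hkK _) 2)
    simpa using (le_abs_self _).trans h2
  have hk2i : ∀ n, Integrable (fun ω => k (a n ω, w n ω) ^ 2) P := fun n =>
    Integrable.of_bound ((hkm n).pow_const 2).aestronglyMeasurable (K ^ 2) (ae_of_all _ fun ω => by
      rw [norm_pow]; exact pow_le_pow_left₀ (norm_nonneg _) (hkK _) 2)
  have hN2 : ∀ n, ∫ ω, N n ω ^ 2 ∂P ≤ K ^ 2 * ∑ i ∈ Finset.range (n + 1), e i ^ 2 := by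
    intro n
    induction n with
    | zero =>
      simp only [hN, zero_add, Finset.sum_range_one, mul_pow, integral_const_mul]
      rw [mul_comm]
      exact mul_le_mul_of_nonneg_right (hk2 0) (sq_nonneg _)
    | succ n ih =>
      have hcross : Integrable (fun ω => N n ω * k (a (n + 1) ω, w (n + 1) ω)) P :=
        (hki (n + 1)).bdd_mul (hNm n).aestronglyMeasurable (ae_of_all _ (hNb n))
      have hexp : ∀ ω, N (n + 1) ω ^ 2 = N n ω ^ 2 +
          (2 * e (n + 1)) * (N n ω * k (a (n + 1) ω, w (n + 1) ω)) +
          e (n + 1) ^ 2 * k (a (n + 1) ω, w (n + 1) ω) ^ 2 := fun ω => by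
        rw [hsucc]; ring
      have h1 := integral_add ((hsqint n).add (hcross.const_mul (2 * e (n + 1))))
        ((hk2i (n + 1)).const_mul (e (n + 1) ^ 2))
      have h2 := integral_add (hsqint n) (hcross.const_mul (2 * e (n + 1)))
      simp only [Pi.add_apply] at h1
      simp only [hexp]
      rw [h1, h2, integral_const_mul, integral_const_mul,
        horth n (N n) _ (hNG n) (hNb n), Finset.sum_range_succ _ (n + 1)]
      have := mul_le_mul_of_nonneg_left (hk2 (n + 1)) (sq_nonneg (e (n + 1)))
      linarith
  have hbdd : ∀ n, eLpNorm (N n) 1 P ≤ ((1 + K ^ 2 * ∑' i, e i ^ 2).toNNReal : NNReal) := by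
    intro n
    rw [eLpNorm_one_eq_lintegral_enorm, ← ofReal_integral_norm_eq_lintegral_enorm (hNi n)]
    refine ENNReal.ofReal_le_ofReal ?_
    calc ∫ ω, ‖N n ω‖ ∂P ≤ ∫ ω, (1 + N n ω ^ 2) ∂P := by
          refine integral_mono (hNi n).norm ((integrable_const _).add (hsqint n)) fun ω => ?_
          simp only [Real.norm_eq_abs]
          rw [← sq_abs]
          nlinarith [sq_nonneg (|N n ω| - 1), sq_nonneg (|N n ω|)]
      _ = 1 + ∫ ω, N n ω ^ 2 ∂P := by
          rw [integral_add (integrable_const _) (hsqint n)]; simp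
      _ ≤ _ := by
          have h1 := hN2 n
          have h2 := he.sum_le_tsum (Finset.range (n + 1)) fun i _ => sq_nonneg (e i)
          nlinarith [mul_le_mul_of_nonneg_left h2 (sq_nonneg K)]
  filter_upwards [hmart.submartingale.exists_ae_tendsto_of_bdd hbdd] with ω ⟨c, hc⟩
  exact ⟨c, (tendsto_add_atTop_iff_nat 1).1 hc⟩

end Martingale

/-! ### Consequences of spherical symmetry. -/

section Spherical

variable {d : ℕ} {ν : Measure (EuclideanSpace ℝ (Fin d))}

theorem SphericallySymmetric.integral_comp (hν : SphericallySymmetric ν)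
    (R : EuclideanSpace ℝ (Fin d) ≃ₗᵢ[ℝ] EuclideanSpace ℝ (Fin d))
    (f : EuclideanSpace ℝ (Fin d) → ℝ) : ∫ x, f (R x) ∂ν = ∫ x, f x ∂ν := by
  have h := R.toHomeomorph.measurableEmbedding.integral_map (μ := ν) f
  simp only [LinearIsometryEquiv.coe_toHomeomorph] at h
  rw [← h, hν R]

/-- The reflection in the hyperplane orthogonal to u - v works. -/
theorem exists_linearIsometryEquiv_apply_eq {u v : EuclideanSpace ℝ (Fin d)} (h : ‖u‖ = ‖v‖) :
    ∃ R : EuclideanSpace ℝ (Fin d) ≃ₗᵢ[ℝ] EuclideanSpace ℝ (Fin d), R u = v :=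
  ⟨_, Submodule.reflection_sub h⟩

theorem SphericallySymmetric.integral_comp_inner (hν : SphericallySymmetric ν)
    {u v : EuclideanSpace ℝ (Fin d)} (h : ‖u‖ = ‖v‖) (f : ℝ → ℝ) :
    ∫ x, f (inner ℝ v x) ∂ν = ∫ x, f (inner ℝ u x) ∂ν := by
  obtain ⟨R, hR⟩ := exists_linearIsometryEquiv_apply_eq h
  rw [← hν.integral_comp R]
  simp only [← hR, LinearIsometryEquiv.inner_map_map]

/-- Expand the cosine of the sum; the sine part is odd and vanishes under x ↦ -x. -/
theorem SphericallySymmetric.integral_cos_add [IsFiniteMeasure ν] (hν : SphericallySymmetric ν)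
    {u v : EuclideanSpace ℝ (Fin d)} (h : ‖u‖ = ‖v‖) (θ lam y : ℝ) :
    ∫ x, Real.cos (lam * (θ * inner ℝ v x + y)) ∂ν =
      (∫ x, Real.cos (lam * (θ * inner ℝ u x)) ∂ν) * Real.cos (lam * y) := by
  have hsin : ∫ x, Real.sin (lam * (θ * inner ℝ v x)) ∂ν = 0 := by
    have := hν.integral_comp (LinearIsometryEquiv.neg ℝ)
      fun x => Real.sin (lam * (θ * inner ℝ v x))
    simp only [LinearIsometryEquiv.coe_neg, inner_neg_right, mul_neg, Real.sin_neg,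
      integral_neg] at this
    linarith
  have hci : Integrable (fun x => Real.cos (lam * (θ * inner ℝ v x))) ν :=
    Integrable.of_bound (Continuous.aestronglyMeasurable (by fun_prop)) 1
      (ae_of_all _ fun _ => Real.abs_cos_le_one _)
  have hsi : Integrable (fun x => Real.sin (lam * (θ * inner ℝ v x))) ν :=
    Integrable.of_bound (Continuous.aestronglyMeasurable (by fun_prop)) 1
      (ae_of_all _ fun _ => Real.abs_sin_le_one _)
  simp only [mul_add lam, Real.cos_add]
  rw [integral_sub (hci.mul_const _) (hsi.mul_const _), integral_mul_const, integral_mul_const,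
    hsin, zero_mul, sub_zero, hν.integral_comp_inner h fun t => Real.cos (lam * (θ * t))]

theorem SphericallySymmetric.ae_inner_eq_zero (hν : SphericallySymmetric ν)
    {u v : EuclideanSpace ℝ (Fin d)} (h : ‖u‖ = ‖v‖) (hu : ∀ᵐ x ∂ν, inner ℝ u x = 0) :
    ∀ᵐ x ∂ν, inner ℝ v x = 0 := by
  obtain ⟨R, hR⟩ := exists_linearIsometryEquiv_apply_eq h
  rw [← hν R]
  rw [ae_map_iff R.continuous.aemeasurable
    (measurableSet_eq_fun (by fun_prop) measurable_const)]
  filter_upwards [hu] with x hx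
  rw [← hR, LinearIsometryEquiv.inner_map_map, hx]

/-- Otherwise the cosine is a.s. 1 for every λ = 1/(n + 3). For large n its argument lies within
(-2π, 2π), so it is 0; thus ⟨u, x⟩ = 0 a.s., by symmetry every coordinate vanishes, and `ν` is the
point mass at 0. -/
theorem SphericallySymmetric.exists_integral_cos_lt_one [IsProbabilityMeasure ν]
    (hν : SphericallySymmetric ν) (hν0 : ν ≠ Measure.dirac 0)
    {u : EuclideanSpace ℝ (Fin d)} (hu : ‖u‖ = 1) {θ : ℝ} (hθ : 0 < θ) :
    ∃ lam : ℝ, 0 < lam ∧ lam ≤ 1 / 3 ∧ ∫ x, Real.cos (lam * (θ * inner ℝ u x)) ∂ν < 1 := by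
  by_contra! hcon
  have hae : ∀ n : ℕ, ∀ᵐ x ∂ν, Real.cos (1 / (n + 3 : ℝ) * (θ * inner ℝ u x)) = 1 := by
    intro n
    set f : EuclideanSpace ℝ (Fin d) → ℝ :=
      fun x => 1 - Real.cos (1 / (n + 3 : ℝ) * (θ * inner ℝ u x)) with hf
    have hci : Integrable (fun x => Real.cos (1 / (n + 3 : ℝ) * (θ * inner ℝ u x))) ν :=
      Integrable.of_bound (Continuous.aestronglyMeasurable (by fun_prop)) 1
        (ae_of_all _ fun _ => Real.abs_cos_le_one _)
    have hf0 : 0 ≤ f := fun x => sub_nonneg.2 (Real.cos_le_one _)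
    have h1 := hcon (1 / (n + 3 : ℝ)) (by positivity)
      (one_div_le_one_div_of_le (by norm_num) (by linarith [n.cast_nonneg (α := ℝ)]))
    have hint : ∫ x, f x ∂ν = 0 := by
      refine le_antisymm ?_ (integral_nonneg hf0)
      rw [hf, integral_sub (integrable_const _) hci]
      simpa using h1
    have h2 := (integral_eq_zero_iff_of_nonneg hf0 ((integrable_const 1).sub hci)).1 hint
    filter_upwards [h2] with x hx
    simp only [hf, Pi.zero_apply] at hx
    linarith
  have hu0 : ∀ᵐ x ∂ν, inner ℝ u x = 0 := by
    filter_upwards [ae_all_iff.2 hae] with x hx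
    set t := θ * inner ℝ u x with ht
    obtain ⟨n, hn⟩ := exists_nat_gt |t|
    have hlt : |1 / (n + 3 : ℝ) * t| < 2 * Real.pi := by
      rw [abs_mul, abs_of_pos (by positivity : (0 : ℝ) < 1 / (n + 3)), one_div_mul_eq_div,
        div_lt_iff₀ (by positivity)]
      nlinarith [Real.pi_gt_three, n.cast_nonneg (α := ℝ)]
    have h0 := (Real.cos_eq_one_iff_of_lt_of_lt (abs_lt.1 hlt).1 (abs_lt.1 hlt).2).1 (hx n)
    have h3 : (1 / (n + 3 : ℝ)) ≠ 0 := by positivity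
    exact (mul_eq_zero.1 ((mul_eq_zero.1 h0).resolve_left h3)).resolve_left hθ.ne'
  have hall : ∀ i : Fin d, ∀ᵐ x ∂ν, inner ℝ (EuclideanSpace.single i (1 : ℝ)) x = 0 := fun i =>
    hν.ae_inner_eq_zero (by simp [hu]) hu0
  have hx0 : (id : EuclideanSpace ℝ (Fin d) → _) =ᵐ[ν] fun _ => 0 := by
    filter_upwards [ae_all_iff.2 hall] with x hx
    ext i
    simpa [EuclideanSpace.inner_single_left] using hx i
  apply hν0
  have h : ν.map id = ν.map fun _ => 0 := Measure.map_congr hx0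
  rwa [Measure.map_id, Measure.map_const, measure_univ, one_smul] at h

end Spherical

/-! ### Almost sure growth along the trajectory. -/

section Trajectory

variable {Ω : Type*} [MeasurableSpace Ω] {P : Measure Ω} {d : ℕ}

theorem ae_tendsto_quadForm_walkState [IsProbabilityMeasure P] {θ : ℝ} (hθ : 0 < θ)
    {ν : Measure (EuclideanSpace ℝ (Fin d))}
    (hν : SphericallySymmetric ν) (hν0 : ν ≠ Measure.dirac 0) {e : ℕ → ℝ}
    (he : ∀ n, 0 < e n ∧ e n < 1) (hratio : Tendsto (fun n => e (n + 1) / e n) atTop (𝓝 1))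
    (hdiv : Tendsto (fun n => ∑ i ∈ Finset.range n, e i) atTop atTop)
    (hsq : Summable fun n => e n ^ 2)
    {q₀ : EuclideanSpace ℝ (Fin d) × EuclideanSpace ℝ (Fin d) × Matrix (Fin d) (Fin d) ℝ}
    (hq₀ : q₀.2.2.PosDef) {w : ℕ → Ω → EuclideanSpace ℝ (Fin d)} (hw : ∀ n, Measurable (w n))
    (hlaw : ∀ n, P.map (w n) = ν) (hind : iIndepFun w P)
    {u : EuclideanSpace ℝ (Fin d)} (hu : ‖u‖ = 1) :
    ∀ᵐ ω ∂P, Tendsto (fun n => quadForm (walkState θ e q₀ (w · ω) n).2.2 u) atTop atTop := by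
  have hνp : IsProbabilityMeasure ν := by
    rw [← hlaw 0]; exact Measure.isProbabilityMeasure_map (hw 0).aemeasurable
  have hu0 : u ≠ 0 := by rintro rfl; simp at hu
  obtain ⟨lam, hlam, hlam', hφ⟩ := hν.exists_integral_cos_lt_one hν0 hu hθ
  set φ := ∫ x, Real.cos (lam * (θ * inner ℝ u x)) ∂ν with hφdef
  have hφabs : |φ| ≤ 1 := by
    have h2 := norm_integral_le_of_norm_le_const (μ := ν)
      (f := fun x => Real.cos (lam * (θ * inner ℝ u x)))
      (C := 1) (ae_of_all _ fun _ => Real.abs_cos_le_one _)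
    simpa using h2
  have hpd : ∀ n ω, (walkState θ e q₀ (w · ω) n).2.2.PosDef := fun n ω =>
    walkState_posDef he hq₀ _ n
  set a : ℕ → Ω → EuclideanSpace ℝ (Fin d) × ℝ := fun n ω =>
    (sqrtDir (walkState θ e q₀ (w · ω) n) u, normDisp (walkState θ e q₀ (w · ω) n) u) with ha
  set k : (EuclideanSpace ℝ (Fin d) × ℝ) × EuclideanSpace ℝ (Fin d) → ℝ := fun p =>
    Real.cos (lam * (θ * inner ℝ p.1.1 p.2 + p.1.2)) - φ * Real.cos (lam * p.1.2) with hk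
  have hws : ∀ n, StronglyMeasurable (w n) := fun n => (hw n).stronglyMeasurable
  -- The σ-algebra at `m` contains `w 0, …, w m`, and `a n` uses only `w 0, …, w (n - 1)`; hence the
  -- bound `m + 1`.
  have hmeas : ∀ n m, n ≤ m + 1 → Measurable[Filtration.natural w hws m] (a n) := by
    intro n m hnm
    have hwG : ∀ i < n, Measurable[Filtration.natural w hws m] (w i) := fun i hi =>
      ((Filtration.stronglyAdapted_natural hws i).mono
        ((Filtration.natural w hws).mono (by omega))).measurable
    obtain ⟨h1, h2, h3⟩ := @measurable_walkState d Ω (Filtration.natural w hws m) θ e q₀ w n hwG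
    exact @measurable_sqrtDir_normDisp d Ω (Filtration.natural w hws m) _ h1 h2 h3 u
  have hkc : Continuous k := by fun_prop
  have hk2 : ∀ p, |k p| ≤ 2 := fun p => by
    refine (abs_sub _ _).trans ?_
    have h1 := Real.abs_cos_le_one (lam * (θ * inner ℝ p.1.1 p.2 + p.1.2))
    have h2 : |φ * Real.cos (lam * p.1.2)| ≤ 1 := by
      rw [abs_mul]; exact mul_le_one₀ hφabs (abs_nonneg _) (Real.abs_cos_le_one _)
    linarith
  have hk0 : ∀ n ω, ∫ x, k (a n ω, x) ∂ν = 0 := by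
    intro n ω
    have hci : Integrable (fun x => Real.cos (lam * (θ * inner ℝ (a n ω).1 x + (a n ω).2))) ν :=
      Integrable.of_bound (Continuous.aestronglyMeasurable (by fun_prop)) 1
        (ae_of_all _ fun _ => Real.abs_cos_le_one _)
    have hnorm : ‖u‖ = ‖(a n ω).1‖ := by rw [hu]; exact (norm_sqrtDir (hpd n ω) hu0).symm
    simp only [hk]
    rw [integral_sub hci (integrable_const _), hν.integral_cos_add hnorm]
    simp [hφdef]
  filter_upwards [ae_tendsto_sum_of_integral_eq_zero hws hlaw hind (hmeas 0 0 (by omega))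
    (fun n => hmeas (n + 1) n le_rfl) hkc.measurable hk2 hk0 hsq] with ω ⟨c, hc⟩
  refine tendsto_atTop_of_compensated_cos
    (Z := fun n => θ * inner ℝ (a n ω).1 (w n ω) + (a n ω).2) (Y := fun n => (a n ω).2)
    he hratio hdiv hsq (quadForm_pos hq₀ hu0) (fun n => ?_) (fun n => ?_)
    hφ (abs_le.1 hφabs).1 hlam hlam' hc
  · exact quadForm_walkStep _ (hpd n ω) hu0 _
  · exact normDisp_walkStep _ (hpd n ω) hu0 _

theorem IsAdaptiveRandomWalk.ae_eq_walkState {θ : ℝ} {η : ℕ → ℝ}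
    {ν : Measure (EuclideanSpace ℝ (Fin d))} {x₁ m₁ : EuclideanSpace ℝ (Fin d)}
    {s₁ : Matrix (Fin d) (Fin d) ℝ} {W X M : ℕ → Ω → EuclideanSpace ℝ (Fin d)}
    {S : ℕ → Ω → Matrix (Fin d) (Fin d) ℝ}
    (h : IsAdaptiveRandomWalk P θ η ν x₁ m₁ s₁ W X M S)
    {w : ℕ → Ω → EuclideanSpace ℝ (Fin d)} (hw : ∀ n, W (n + 2) =ᵐ[P] w n) :
    ∀ᵐ ω ∂P, ∀ n, (X (n + 1) ω, M (n + 1) ω, S (n + 1) ω) =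
      walkState θ (fun n => η (n + 2)) (x₁, m₁, s₁) (w · ω) n := by
  filter_upwards [h.init_X, h.init_M, h.init_S, ae_all_iff.2 hw,
    ae_all_iff.2 fun n => h.rec_X (n + 1) (by omega),
    ae_all_iff.2 fun n => h.rec_M (n + 1) (by omega),
    ae_all_iff.2 fun n => h.rec_S (n + 1) (by omega)] with ω hX hM hS hW rX rM rS n
  induction n with
  | zero => simp [walkState, hX, hM, hS]
  | succ n ih =>
    rw [walkState, ← ih, ← hW]
    simp only [walkStep]
    rw [rM, rS, rX]

end Trajectory

/-! ### The main theorem. -/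

theorem mainTheorem2 {Ω : Type*} [MeasurableSpace Ω] (P : Measure Ω) [IsProbabilityMeasure P]
    {d : ℕ} (θ : ℝ) (hθ : 0 < θ)
    (ν : Measure (EuclideanSpace ℝ (Fin d)))
    (hν : SphericallySymmetric ν) (hν0 : ν ≠ Measure.dirac 0)
    (η : ℕ → ℝ) (hη : ∀ n, 2 ≤ n → 0 < η n ∧ η n < 1)
    (hη_ratio : Tendsto (fun n : ℕ => η (n + 1) / η n) atTop (𝓝 1))
    (hη_div : Tendsto (fun N : ℕ => ∑ n ∈ Finset.Icc 2 N, η n) atTop atTop)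
    (hη_sq : Summable (fun n : ℕ => η (n + 2) ^ 2))
    (x₁ m₁ : EuclideanSpace ℝ (Fin d)) (s₁ : Matrix (Fin d) (Fin d) ℝ) (hs₁ : s₁.PosDef)
    (W X M : ℕ → Ω → EuclideanSpace ℝ (Fin d))
    (S : ℕ → Ω → Matrix (Fin d) (Fin d) ℝ)
    (hwalk : IsAdaptiveRandomWalk P θ η ν x₁ m₁ s₁ W X M S)
    (u : EuclideanSpace ℝ (Fin d)) (hu : ‖u‖ = 1) :
    ∀ᵐ ω ∂P, Tendsto (fun n : ℕ => quadForm (S n ω) u) atTop atTop := by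

  -- The `W n` are only a.e. measurable; the natural filtration needs measurable versions. The shift
  -- by 2 makes `w n` drive the step from time n + 1 to n + 2.
  obtain ⟨w, hw⟩ : ∃ w : ℕ → Ω → EuclideanSpace ℝ (Fin d),
      ∀ n, Measurable (w n) ∧ W (n + 2) =ᵐ[P] w n :=
    ⟨fun n => (hwalk.law_W (n + 2) (by omega)).aemeasurable.mk, fun n =>
      ⟨AEMeasurable.measurable_mk _, AEMeasurable.ae_eq_mk _⟩⟩
  have hlaw : ∀ n, P.map (w n) = ν := fun n => by
    rw [← Measure.map_congr (hw n).2]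
    exact (hwalk.law_W (n + 2) (by omega)).map_eq
  have hind : iIndepFun w P := (iIndepFun_congr fun n => (hw n).2).1 hwalk.indep_W
  have hdiv : Tendsto (fun n => ∑ i ∈ Finset.range n, η (i + 2)) atTop atTop := by
    refine (hη_div.comp (tendsto_add_atTop_nat 1)).congr fun n => ?_
    rw [Function.comp_apply, ← Finset.Ico_succ_right_eq_Icc, Finset.sum_Ico_eq_sum_range]
    simp [add_comm, show 1 + (n + 1) - 2 = n by omega]
  filter_upwards [hwalk.ae_eq_walkState fun n => (hw n).2,
    ae_tendsto_quadForm_walkState (q₀ := (x₁, m₁, s₁)) hθ hν hν0 (fun n => hη (n + 2) (by omega))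
      (hη_ratio.comp (tendsto_add_atTop_nat 2)) hdiv hη_sq hs₁ (fun n => (hw n).1) hlaw hind hu]
    with ω hω htend
  refine (tendsto_add_atTop_iff_nat 1).1 (htend.congr fun n => ?_)
  rw [← hω]
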